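/- For complex parameters $a,b,c$ with $c\notin\{0,-1,-2,\dots\}$ let $$ {}_2F_1(a,b;c;t)=\sum_{n\ge 0}\frac{(a)_n(b)_n}{(c)_n\,n!}\,t^n ,\qquad (x)_n=x(x+1)\cdots(x+n-1), $$ for $|t|<1$ (and for every $t\in\mathbb{C}$ when the series terminates). The principal branch of ${}_2F_1(a,b;c;\cdot)$ is the analytic function on $\mathbb{C}\setminus[1,\infty)$ that agrees with this series on $|t|<1$. Powers $w^{s}$ are principal. Proposition. Let $m\ge 0$ be an integer. The principal branch of ${}_2F_1(m+\tfrac54,\tfrac34;m+\tfrac32;\cdot)$ on $\mathbb{C}\setminus[1,\infty)$ exists, and with it the identity $$ {}_2F_1\left(-m,\,m+1;\,m+\tfrac32;\,z\right)=(1-2z)\,(1-z)^{m+\frac12}\;{}_2F_1\left(m+\tfrac54,\,\tfrac34;\,m+\tfrac32;\,4z(1-z)\right) $$ holds for every complex $z$ with $\operatorname{Re} z<\tfrac12$. In particular, it holds with the convergent power series on the right-hand side for every complex $z$ with $\operatorname{Re} z<\tfrac12$ and $|4z(1-z)|<1$. -/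

import Mathlib

/-- `F` is the principal branch of the Gauss hypergeometric function with parameters `a, b; c`: it
is analytic on `ℂ` cut along the real half-line `[1, ∞)` (that is, wherever `1 - t` is not a real
number `≤ 0`), and on the open unit disc it is the sum of the hypergeometric series. -/
structure IsPrincipalHypergeometric (a b c : ℂ) (F : ℂ → ℂ) : Prop where
  analytic : AnalyticOnNhd ℂ F {t : ℂ | 1 - t ∈ Complex.slitPlane}
  eq_series : ∀ t : ℂ, ‖t‖ < 1 → F t = ₂F₁ a b c t

/-! Put `t = 4z(1-z)`. Then `1 - t = (1-2z)²`, and for `Re z < 1/2` the principal root of `1 - t` is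
`1 - 2z`, so `z = (1 - √(1-t))/2`. Solving the identity for its last factor gives an explicit
function of `t`, `quadraticBranch`, analytic on the whole cut plane. The polynomial on the left
satisfies its hypergeometric equation, which becomes under this substitution the equation with
parameters `m+5/4, 3/4; m+3/2` (`quadraticBranch_ode`). As `quadraticBranch` is regular at `0` with
value `1`, it is the series on the disc (`eq_ordinaryHypergeometric_of_ode`). The identity theorem
then equates it with any principal branch. -/

theorem ascPochhammer_eval_half_odd_ne_zero (m n : ℕ) :
    (ascPochhammer ℂ n).eval ((m : ℂ) + 3 / 2) ≠ 0 := by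
  rw [Ne, ascPochhammer_eval_eq_zero_iff]
  rintro ⟨k, -, hk⟩
  have := congrArg Complex.re hk
  norm_num at this
  linarith [(Nat.cast_nonneg k : (0 : ℝ) ≤ k), (Nat.cast_nonneg m : (0 : ℝ) ≤ m)]

/-! ### The terminating series and its differential equation -/

/-- The polynomial which is the sum of the terminating series `₂F₁ (-m) b c`. -/
noncomputable def terminatingHypergeometric (m : ℕ) (b c : ℂ) : Polynomial ℂ :=
  ∑ k ∈ Finset.range (m + 1),
    Polynomial.C (ordinaryHypergeometricCoefficient (-(m : ℂ)) b c k) * Polynomial.X ^ k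

theorem ordinaryHypergeometricCoefficient_eq_zero_of_lt {m n : ℕ} (b c : ℂ) (h : m < n) :
    ordinaryHypergeometricCoefficient (-(m : ℂ)) b c n = 0 := by
  simp [ordinaryHypergeometricCoefficient, ascPochhammer_eval_neg_coe_nat_of_lt h]

theorem coeff_terminatingHypergeometric (m : ℕ) (b c : ℂ) (n : ℕ) :
    (terminatingHypergeometric m b c).coeff n =
      ordinaryHypergeometricCoefficient (-(m : ℂ)) b c n := by
  simp only [terminatingHypergeometric, Polynomial.finsetSum_coeff, Polynomial.coeff_C_mul_X_pow,
    Finset.sum_ite_eq, Finset.mem_range]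
  split_ifs with h
  · rfl
  · exact (ordinaryHypergeometricCoefficient_eq_zero_of_lt b c (by omega)).symm

theorem eval_terminatingHypergeometric (m : ℕ) (b c z : ℂ) :
    (terminatingHypergeometric m b c).eval z = ₂F₁ (-(m : ℂ)) b c z := by
  rw [ordinaryHypergeometric_eq_tsum]
  simp only [smul_eq_mul]
  rw [tsum_eq_sum (s := Finset.range (m + 1)), terminatingHypergeometric,
    Polynomial.eval_finsetSum]
  · simp
  · intro n hn
    have := ordinaryHypergeometricCoefficient_eq_zero_of_lt (m := m) (n := n) b c
      (by simpa using hn)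
    rw [ordinaryHypergeometricCoefficient] at this
    rw [this, zero_mul]

theorem ordinaryHypergeometricCoefficient_succ {a b c : ℂ} {n : ℕ}
    (hc : (ascPochhammer ℂ (n + 1)).eval c ≠ 0) :
    (c + n) * (n + 1) * ordinaryHypergeometricCoefficient a b c (n + 1) =
      (a + n) * (b + n) * ordinaryHypergeometricCoefficient a b c n := by
  simp only [ordinaryHypergeometricCoefficient, ascPochhammer_succ_eval, Nat.factorial_succ,
    Nat.cast_mul, Nat.cast_add, Nat.cast_one] at hc ⊢
  have h1 : (n : ℂ) + 1 ≠ 0 := by exact_mod_cast n.succ_ne_zero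
  have h2 : (n.factorial : ℂ) ≠ 0 := by exact_mod_cast n.factorial_ne_zero
  have h3 := left_ne_zero_of_mul hc
  have h4 := right_ne_zero_of_mul hc
  field_simp

open Polynomial in
-- Comparing coefficients of `X ^ n` gives exactly the two-term recursion
-- `ordinaryHypergeometricCoefficient_succ`.
theorem terminatingHypergeometric_ode (m : ℕ) (b c : ℂ)
    (hc : ∀ n, (ascPochhammer ℂ n).eval c ≠ 0) :
    X * derivative (derivative (terminatingHypergeometric m b c)) -
      X * (X * derivative (derivative (terminatingHypergeometric m b c))) +
      C c * derivative (terminatingHypergeometric m b c) -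
      C (-(m : ℂ) + b + 1) * (X * derivative (terminatingHypergeometric m b c)) -
      C (-(m : ℂ) * b) * terminatingHypergeometric m b c = 0 := by
  ext n
  have h := ordinaryHypergeometricCoefficient_succ (a := -(m : ℂ)) (b := b) (hc (n + 1))
  -- The factor `X * X` makes the coefficients of degree `0` and `1` separate cases.
  rcases n with _ | _ | n <;>
  · simp only [coeff_sub, coeff_add, coeff_C_mul, coeff_X_mul, coeff_X_mul_zero, coeff_derivative,
      coeff_terminatingHypergeometric, coeff_zero] at h ⊢
    push_cast at h ⊢
    linear_combination h

theorem eval_terminatingHypergeometric_ode (m : ℕ) (b c : ℂ)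
    (hc : ∀ n, (ascPochhammer ℂ n).eval c ≠ 0) (z : ℂ) :
    z * (1 - z) * (terminatingHypergeometric m b c).derivative.derivative.eval z +
      (c - (-(m : ℂ) + b + 1) * z) * (terminatingHypergeometric m b c).derivative.eval z -
      -(m : ℂ) * b * (terminatingHypergeometric m b c).eval z = 0 := by
  have h := congrArg (Polynomial.eval z) (terminatingHypergeometric_ode m b c hc)
  simp only [Polynomial.eval_sub, Polynomial.eval_add, Polynomial.eval_mul, Polynomial.eval_X,
    Polynomial.eval_C, Polynomial.eval_zero] at h
  linear_combination h

/-! ### Solutions regular at the origin -/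

/-- Every derivative of a solution of the hypergeometric equation satisfies the hypergeometric
equation with shifted parameters. -/
theorem iteratedDeriv_hypergeometric_ode {a b c : ℂ} {G : ℂ → ℂ} {U : Set ℂ} (hU : IsOpen U)
    (hG : AnalyticOnNhd ℂ G U)
    (hode : ∀ t ∈ U, t * (1 - t) * deriv (deriv G) t + (c - (a + b + 1) * t) * deriv G t -
      a * b * G t = 0) (n : ℕ) :
    ∀ t ∈ U, t * (1 - t) * iteratedDeriv (n + 2) G t +
      (c + n - (a + b + 1 + 2 * n) * t) * iteratedDeriv (n + 1) G t -
      (a + n) * (b + n) * iteratedDeriv n G t = 0 := by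
  have hd : ∀ k, ∀ t ∈ U, HasDerivAt (iteratedDeriv k G) (iteratedDeriv (k + 1) G t) t := by
    intro k t ht
    rw [iteratedDeriv_succ]
    refine DifferentiableAt.hasDerivAt ?_
    rw [iteratedDeriv_eq_iterate]
    exact (hG.iterated_deriv k t ht).differentiableAt
  induction n with
  | zero =>
    intro t ht
    simpa [iteratedDeriv_succ, iteratedDeriv_zero] using hode t ht
  | succ n ih =>
    intro t ht
    have hid := hasDerivAt_id t
    have h := (((hid.mul (hid.const_sub 1)).mul (hd (n + 2) t ht)).add
      (((hid.const_mul (a + b + 1 + 2 * n)).const_sub (c + n)).mul (hd (n + 1) t ht))).sub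
      ((hd n t ht).const_mul ((a + n) * (b + n)))
    have h0 := h.unique ((hasDerivAt_const t (0 : ℂ)).congr_of_eventuallyEq
      (Filter.eventually_of_mem (hU.mem_nhds ht) fun x hx => ih x hx))
    simp only [id_eq, Pi.mul_apply] at h0
    push_cast
    rw [show n + 1 + 2 = n + 2 + 1 from rfl, show n + 1 + 1 = n + 2 from rfl]
    linear_combination h0

/-- The solution of the hypergeometric equation that is regular at the origin is the sum of the
hypergeometric series. -/
theorem eq_ordinaryHypergeometric_of_ode {a b c : ℂ} (hc : ∀ n, (ascPochhammer ℂ n).eval c ≠ 0)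
    {G : ℂ → ℂ} (hG : AnalyticOnNhd ℂ G (Metric.ball 0 1))
    (hode : ∀ t ∈ Metric.ball (0 : ℂ) 1, t * (1 - t) * deriv (deriv G) t +
      (c - (a + b + 1) * t) * deriv G t - a * b * G t = 0) (h1 : G 0 = 1) {t : ℂ} (ht : ‖t‖ < 1) :
    G t = ₂F₁ a b c t := by
  have hcoef : ∀ n, iteratedDeriv n G 0 = (ascPochhammer ℂ n).eval a *
      (ascPochhammer ℂ n).eval b * ((ascPochhammer ℂ n).eval c)⁻¹ := by
    intro n
    induction n with
    | zero => simp [h1]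
    | succ n ih =>
      -- At `t = 0` the leading coefficient `t * (1 - t)` vanishes, leaving a recursion for the
      -- Taylor coefficients.
      have h := iteratedDeriv_hypergeometric_ode Metric.isOpen_ball hG hode n 0 (by simp)
      have hcn := hc (n + 1)
      rw [ih] at h
      simp only [ascPochhammer_succ_eval] at hcn ⊢
      have h3 := left_ne_zero_of_mul hcn
      have h4 := right_ne_zero_of_mul hcn
      have h5 : (c + n) * iteratedDeriv (n + 1) G 0 = (a + n) * (b + n) *
        ((ascPochhammer ℂ n).eval a * (ascPochhammer ℂ n).eval b *
          ((ascPochhammer ℂ n).eval c)⁻¹) := by linear_combination h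
      refine mul_left_cancel₀ h4 (h5.trans ?_)
      field_simp
  have hs := Complex.hasSum_taylorSeries_on_ball (f := G) (c := 0) (r := 1) (z := t)
    hG.differentiableOn (by simpa using ht)
  rw [ordinaryHypergeometric_eq_tsum, ← hs.tsum_eq]
  refine tsum_congr fun n => ?_
  simp only [hcoef, smul_eq_mul, sub_zero]
  ring

/-! ### The closed form on the cut plane -/

theorem Complex.re_cpow_two_inv_pos {u : ℂ} (hu : u ∈ Complex.slitPlane) :
    0 < (u ^ (2⁻¹ : ℂ)).re := by
  rw [Complex.cpow_inv_two_re]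
  refine Real.sqrt_pos.2 (half_pos ?_)
  have h := Complex.abs_re_le_norm u
  rcases hu with h' | h'
  · linarith [norm_nonneg u]
  · have := Complex.abs_re_lt_norm.2 h'
    linarith [neg_abs_le u.re]

theorem Complex.hasDerivAt_one_sub_cpow_two_inv {t : ℂ} (ht : 1 - t ∈ Complex.slitPlane) :
    HasDerivAt (fun t : ℂ => (1 - t) ^ (2⁻¹ : ℂ)) (-1 / (2 * (1 - t) ^ (2⁻¹ : ℂ))) t := by
  refine (((hasDerivAt_id t).const_sub 1).cpow_const (c := 2⁻¹) ht).congr_deriv ?_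
  rw [id_eq, Complex.cpow_sub _ _ (Complex.slitPlane_ne_zero ht), Complex.cpow_one]
  have h0 := Complex.slitPlane_ne_zero ht
  have h1 : ((1 - t) ^ (2⁻¹ : ℂ)) ^ 2 = 1 - t := Complex.cpow_nat_inv_pow _ two_ne_zero
  have h2 : (1 - t) ^ (2⁻¹ : ℂ) ≠ 0 := fun h => by
    rw [h] at h1
    exact h0 (by simpa using h1.symm)
  generalize (1 - t) ^ (2⁻¹ : ℂ) = s at *
  rw [← h1]
  field_simp

/-- The right-hand factor of the quadratic transformation in closed form, as a function of
`t = 4 z (1 - z)`, so that `z = (1 - √(1 - t)) / 2`. -/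
noncomputable def quadraticBranch (m : ℕ) (t : ℂ) : ℂ :=
  (terminatingHypergeometric m (m + 1) (m + 3 / 2)).eval ((1 - (1 - t) ^ (2⁻¹ : ℂ)) / 2) *
    ((1 + (1 - t) ^ (2⁻¹ : ℂ)) / 2) ^ (-((m : ℂ) + 1 / 2)) / (1 - t) ^ (2⁻¹ : ℂ)

/-- Off the cut the principal root has positive real part, so this base of the power in
`quadraticBranch` never meets the branch cut. -/
theorem half_one_add_sqrt_mem_slitPlane {t : ℂ} (ht : 1 - t ∈ Complex.slitPlane) :
    (1 + (1 - t) ^ (2⁻¹ : ℂ)) / 2 ∈ Complex.slitPlane := by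
  left
  have := Complex.re_cpow_two_inv_pos ht
  have h : ((1 + (1 - t) ^ (2⁻¹ : ℂ)) / 2).re = (1 + ((1 - t) ^ (2⁻¹ : ℂ)).re) / 2 := by simp
  rw [h]
  linarith

theorem hasDerivAt_eval_mul_cpow (p : Polynomial ℂ) (ν : ℂ) {t : ℂ}
    (ht : 1 - t ∈ Complex.slitPlane) :
    HasDerivAt (fun t : ℂ => p.eval ((1 - (1 - t) ^ (2⁻¹ : ℂ)) / 2) *
      ((1 + (1 - t) ^ (2⁻¹ : ℂ)) / 2) ^ (-ν))
      ((p.derivative.eval ((1 - (1 - t) ^ (2⁻¹ : ℂ)) / 2) +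
        p.eval ((1 - (1 - t) ^ (2⁻¹ : ℂ)) / 2) * ν / ((1 + (1 - t) ^ (2⁻¹ : ℂ)) / 2)) *
        ((1 + (1 - t) ^ (2⁻¹ : ℂ)) / 2) ^ (-ν) / (4 * (1 - t) ^ (2⁻¹ : ℂ))) t := by
  have hs := Complex.hasDerivAt_one_sub_cpow_two_inv ht
  have hw := half_one_add_sqrt_mem_slitPlane ht
  have hw0 := Complex.slitPlane_ne_zero hw
  have hs0 : (1 - t) ^ (2⁻¹ : ℂ) ≠ 0 := fun h => by
    simpa [h] using Complex.re_cpow_two_inv_pos ht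
  have h := ((p.hasDerivAt _).comp t ((hs.const_sub 1).div_const 2)).mul
    (((hs.const_add 1).div_const 2).cpow_const (c := -ν) hw)
  refine h.congr_deriv ?_
  rw [Complex.cpow_sub _ _ hw0, Complex.cpow_one]
  simp only [Function.comp_apply]
  generalize (1 - t) ^ (2⁻¹ : ℂ) = s at *
  generalize hwd : (1 + s) / 2 = w at *
  field_simp
  ring

theorem one_sub_mem_slitPlane_of_norm_lt_one {t : ℂ} (ht : ‖t‖ < 1) :
    1 - t ∈ Complex.slitPlane := by
  rw [sub_eq_add_neg]
  exact Complex.mem_slitPlane_of_norm_lt_one (by simpa using ht)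

theorem isOpen_one_sub_mem_slitPlane : IsOpen {t : ℂ | 1 - t ∈ Complex.slitPlane} :=
  Complex.isOpen_slitPlane.preimage (continuous_const.sub continuous_id)

theorem isPreconnected_one_sub_mem_slitPlane :
    IsPreconnected {t : ℂ | 1 - t ∈ Complex.slitPlane} := by
  have h : {t : ℂ | 1 - t ∈ Complex.slitPlane} = (fun u => 1 - u) '' Complex.slitPlane := by
    ext t
    exact ⟨fun h => ⟨1 - t, h, by ring⟩, by rintro ⟨u, hu, rfl⟩; simpa using hu⟩
  rw [h]
  exact (Complex.starConvex_one_slitPlane.isPathConnected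
    Complex.one_mem_slitPlane).isConnected.isPreconnected.image _ (by fun_prop)

/-- The derivative is kept in terms of `p * w ^ (-ν)` and `p' * w ^ (-ν)`, so that
`hasDerivAt_eval_mul_cpow` yields the second derivative too. -/
theorem hasDerivAt_quadraticBranch (m : ℕ) {t : ℂ} (ht : 1 - t ∈ Complex.slitPlane) :
    HasDerivAt (quadraticBranch m)
      (((terminatingHypergeometric m (m + 1) (m + 3 / 2)).derivative.eval
            ((1 - (1 - t) ^ (2⁻¹ : ℂ)) / 2) *
          ((1 + (1 - t) ^ (2⁻¹ : ℂ)) / 2) ^ (-((m : ℂ) + 1 / 2)) +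
        ((m : ℂ) + 1 / 2) * ((terminatingHypergeometric m (m + 1) (m + 3 / 2)).eval
            ((1 - (1 - t) ^ (2⁻¹ : ℂ)) / 2) *
          ((1 + (1 - t) ^ (2⁻¹ : ℂ)) / 2) ^ (-((m : ℂ) + 1 / 2))) /
            ((1 + (1 - t) ^ (2⁻¹ : ℂ)) / 2)) / (4 * ((1 - t) ^ (2⁻¹ : ℂ)) ^ 2) +
        (terminatingHypergeometric m (m + 1) (m + 3 / 2)).eval
            ((1 - (1 - t) ^ (2⁻¹ : ℂ)) / 2) *
          ((1 + (1 - t) ^ (2⁻¹ : ℂ)) / 2) ^ (-((m : ℂ) + 1 / 2)) /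
            (2 * ((1 - t) ^ (2⁻¹ : ℂ)) ^ 3)) t := by
  have hs0 : (1 - t) ^ (2⁻¹ : ℂ) ≠ 0 := fun h => by
    simpa [h] using Complex.re_cpow_two_inv_pos ht
  have hw0 := Complex.slitPlane_ne_zero (half_one_add_sqrt_mem_slitPlane ht)
  refine ((hasDerivAt_eval_mul_cpow (terminatingHypergeometric m (m + 1) (m + 3 / 2))
    ((m : ℂ) + 1 / 2) ht).div (Complex.hasDerivAt_one_sub_cpow_two_inv ht) hs0).congr_deriv ?_
  generalize ((1 + (1 - t) ^ (2⁻¹ : ℂ)) / 2) ^ (-((m : ℂ) + 1 / 2)) = Q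
  generalize hwd : (1 + (1 - t) ^ (2⁻¹ : ℂ)) / 2 = w at *
  generalize (1 - t) ^ (2⁻¹ : ℂ) = s at *
  field_simp
  ring

theorem quadraticBranch_ode (m : ℕ) {t : ℂ} (ht : 1 - t ∈ Complex.slitPlane) :
    t * (1 - t) * deriv (deriv (quadraticBranch m)) t +
      (((m : ℂ) + 3 / 2) - (((m : ℂ) + 5 / 4) + 3 / 4 + 1) * t) * deriv (quadraticBranch m) t -
      ((m : ℂ) + 5 / 4) * (3 / 4) * quadraticBranch m t = 0 := by
  have hs0 : (1 - t) ^ (2⁻¹ : ℂ) ≠ 0 := fun h => by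
    simpa [h] using Complex.re_cpow_two_inv_pos ht
  have hs2 : ((1 - t) ^ (2⁻¹ : ℂ)) ^ 2 = 1 - t := Complex.cpow_nat_inv_pow _ two_ne_zero
  have hw0 := Complex.slitPlane_ne_zero (half_one_add_sqrt_mem_slitPlane ht)
  have hs := Complex.hasDerivAt_one_sub_cpow_two_inv ht
  have h0 := hasDerivAt_eval_mul_cpow (terminatingHypergeometric m (m + 1) (m + 3 / 2))
    ((m : ℂ) + 1 / 2) ht
  have h1 := hasDerivAt_eval_mul_cpow (terminatingHypergeometric m (m + 1) (m + 3 / 2)).derivative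
    ((m : ℂ) + 1 / 2) ht
  have h2 := (((h1.add ((h0.const_mul ((m : ℂ) + 1 / 2)).div ((hs.const_add 1).div_const 2)
    hw0)).div ((hs.pow 2).const_mul 4) (by simpa using hs0)).add
    (h0.div ((hs.pow 3).const_mul 2) (by simpa using hs0)))
  have h3 := (h2.congr_of_eventuallyEq (Filter.eventually_of_mem
    (isOpen_one_sub_mem_slitPlane.mem_nhds ht)
    fun x hx => (hasDerivAt_quadraticBranch m hx).deriv)).deriv
  have hP := eval_terminatingHypergeometric_ode m ((m : ℂ) + 1) ((m : ℂ) + 3 / 2)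
    (ascPochhammer_eval_half_odd_ne_zero m) ((1 - (1 - t) ^ (2⁻¹ : ℂ)) / 2)
  rw [h3, (hasDerivAt_quadraticBranch m ht).deriv, quadraticBranch]
  simp only [Pi.add_apply, Pi.pow_apply, Pi.div_apply, Nat.cast_ofNat, Nat.reduceSub, pow_one]
  generalize ((1 + (1 - t) ^ (2⁻¹ : ℂ)) / 2) ^ (-((m : ℂ) + 1 / 2)) = Q at *
  generalize (1 - t) ^ (2⁻¹ : ℂ) = s at *
  clear h0 h1 h2 h3 hs
  -- With `t` eliminated, everything is rational in `s`, and the claim is a multiple of the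
  -- polynomial's equation `hP` at `z = (1 - s) / 2`.
  obtain rfl : t = 1 - s ^ 2 := by rw [hs2, sub_sub_cancel]
  have hw1 : 1 + s ≠ 0 := fun h => hw0 (by rw [h, zero_div])
  generalize Polynomial.eval ((1 - s) / 2) _ = p2 at *
  generalize Polynomial.eval ((1 - s) / 2) _ = p1 at *
  generalize Polynomial.eval ((1 - s) / 2) _ = p0 at *
  field_simp
  linear_combination 16 * Q * s ^ 4 * (1 + s) ^ 2 * hP

theorem analyticOnNhd_quadraticBranch (m : ℕ) :
    AnalyticOnNhd ℂ (quadraticBranch m) {t : ℂ | 1 - t ∈ Complex.slitPlane} :=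
  DifferentiableOn.analyticOnNhd
    (fun _ ht => (hasDerivAt_quadraticBranch m ht).differentiableAt.differentiableWithinAt)
    isOpen_one_sub_mem_slitPlane

theorem isPrincipalHypergeometric_quadraticBranch (m : ℕ) :
    IsPrincipalHypergeometric ((m : ℂ) + 5 / 4) (3 / 4) ((m : ℂ) + 3 / 2) (quadraticBranch m) where
  analytic := analyticOnNhd_quadraticBranch m
  eq_series t ht := by
    have hsub : Metric.ball (0 : ℂ) 1 ⊆ {t : ℂ | 1 - t ∈ Complex.slitPlane} := fun t ht =>
      one_sub_mem_slitPlane_of_norm_lt_one (by simpa using ht)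
    refine eq_ordinaryHypergeometric_of_ode (ascPochhammer_eval_half_odd_ne_zero m)
      ((analyticOnNhd_quadraticBranch m).mono hsub)
      (fun t ht => quadraticBranch_ode m (hsub ht)) ?_ ht
    simp [quadraticBranch, eval_terminatingHypergeometric]

/-! ### Uniqueness of the branch and return to `z` -/

theorem IsPrincipalHypergeometric.eqOn {a b c : ℂ} {F G : ℂ → ℂ}
    (hF : IsPrincipalHypergeometric a b c F) (hG : IsPrincipalHypergeometric a b c G) :
    Set.EqOn F G {t : ℂ | 1 - t ∈ Complex.slitPlane} := by
  refine hF.analytic.eqOn_of_preconnected_of_eventuallyEq hG.analytic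
    isPreconnected_one_sub_mem_slitPlane (z₀ := 0) (by simp) ?_
  filter_upwards [Metric.ball_mem_nhds (0 : ℂ) one_pos] with t ht
  have ht' : ‖t‖ < 1 := by simpa using ht
  rw [hF.eq_series t ht', hG.eq_series t ht']

/-- The square of a number with positive real part is never a real number `≤ 0`. -/
theorem one_sub_four_mul_mem_slitPlane {z : ℂ} (hz : z.re < 1 / 2) :
    1 - 4 * z * (1 - z) ∈ Complex.slitPlane := by
  have h : 1 - 4 * z * (1 - z) = (1 - 2 * z) ^ 2 := by ring
  have hre : 0 < 1 - 2 * z.re := by linarith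
  rw [h, Complex.mem_slitPlane_iff]
  by_cases hi : z.im = 0
  · left
    simp [pow_two, hi]
    positivity
  · right
    have h2 : ((1 - 2 * z) ^ 2).im = -4 * (1 - 2 * z.re) * z.im := by
      simp [pow_two]
      ring
    rw [h2]
    exact mul_ne_zero (by linarith) hi

theorem ordinaryHypergeometric_eq_mul_quadraticBranch (m : ℕ) {z : ℂ} (hz : z.re < 1 / 2) :
    ₂F₁ (-(m : ℂ)) ((m : ℂ) + 1) ((m : ℂ) + 3 / 2) z =
      (1 - 2 * z) * (1 - z) ^ ((m : ℂ) + 1 / 2) * quadraticBranch m (4 * z * (1 - z)) := by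
  have hre : 0 < (1 - 2 * z).re := by
    simp
    linarith
  -- Here `Re z < 1/2` selects the root `1 - 2z` rather than its negative.
  have hs : (1 - 4 * z * (1 - z)) ^ (2⁻¹ : ℂ) = 1 - 2 * z := by
    rw [show 1 - 4 * z * (1 - z) = (1 - 2 * z) ^ 2 by ring, Complex.sq_cpow_two_inv hre]
  have hs0 : 1 - 2 * z ≠ 0 := fun h => by simp [h] at hre
  have hz0 : 1 - z ≠ 0 := fun h => by
    have := congrArg Complex.re h
    simp at this
    linarith
  have hQ : (1 - z) ^ ((m : ℂ) + 1 / 2) ≠ 0 := by simp [Complex.cpow_eq_zero_iff, hz0]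
  rw [quadraticBranch, hs, show (1 - (1 - 2 * z)) / 2 = z by ring,
    show (1 + (1 - 2 * z)) / 2 = 1 - z by ring, Complex.cpow_neg, eval_terminatingHypergeometric]
  generalize (1 - z) ^ ((m : ℂ) + 1 / 2) = Q at *
  field_simp

theorem mainTheorem6 (m : ℕ) :
    (∀ z : ℂ, z.re < 1 / 2 → ‖4 * z * (1 - z)‖ < 1 →
      ₂F₁ (-(m : ℂ)) ((m : ℂ) + 1) ((m : ℂ) + 3 / 2) z =
        (1 - 2 * z) * (1 - z) ^ ((m : ℂ) + 1 / 2) *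
          ₂F₁ ((m : ℂ) + 5 / 4) (3 / 4 : ℂ) ((m : ℂ) + 3 / 2) (4 * z * (1 - z))) ∧
    (∃ F : ℂ → ℂ,
      IsPrincipalHypergeometric ((m : ℂ) + 5 / 4) (3 / 4) ((m : ℂ) + 3 / 2) F) ∧
    (∀ F : ℂ → ℂ,
      IsPrincipalHypergeometric ((m : ℂ) + 5 / 4) (3 / 4) ((m : ℂ) + 3 / 2) F →
      ∀ z : ℂ, z.re < 1 / 2 →
        ₂F₁ (-(m : ℂ)) ((m : ℂ) + 1) ((m : ℂ) + 3 / 2) z =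
          (1 - 2 * z) * (1 - z) ^ ((m : ℂ) + 1 / 2) * F (4 * z * (1 - z))) := by
  have hG := isPrincipalHypergeometric_quadraticBranch m
  refine ⟨fun z hz ht => ?_, ⟨_, hG⟩, fun F hF z hz => ?_⟩
  · rw [← hG.eq_series _ ht]
    exact ordinaryHypergeometric_eq_mul_quadraticBranch m hz
  · rw [hF.eqOn hG (one_sub_four_mul_mem_slitPlane hz)]
    exact ordinaryHypergeometric_eq_mul_quadraticBranch m hz
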